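/- For real numbers $a_0 \ge b_0 > 0$ let the cubic arithmetic-geometric mean iteration be $$a_{n+1}=\frac{a_n+2b_n}{3},\qquad b_{n+1}=\sqrt[3]{\,b_n\,\frac{a_n^2+a_nb_n+b_n^2}{3}\,}\qquad(n\ge 0),$$ and let $\mathsf{ag}_3(a_0,b_0)$ denote the common limit of the sequences $(a_n)$ and $(b_n)$. Put $$\mathcal{L}_+=\frac{\Gamma(\frac13)\,\Gamma(\frac56)}{\Gamma(\frac16)},$$ which is the conjectural value of Landau's constant. Then, for the starting values $a_0=\sqrt[3]{2}$, $b_0=1$, the sequences $(a_n)$ and $(b_n)$ do converge to a common limit $\mathsf{ag}_3(\sqrt[3]{2},1)$, and $$\mathsf{ag}_3(\sqrt[3]{2},1)=2\,\mathcal{L}_+ .$$ -/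

import Mathlib

open Filter Topology

/-- One step `(a, b) ↦ ((a + 2b)/3, ∛(b (a² + ab + b²)/3))` of the cubic arithmetic-geometric
mean iteration. For `a, b > 0`, the only case of interest, the radicand is positive, so the real
power `1/3` is the real cube root. -/
noncomputable def cubicAGStep (p : ℝ × ℝ) : ℝ × ℝ :=
  ((p.1 + 2 * p.2) / 3, (p.2 * ((p.1 ^ 2 + p.1 * p.2 + p.2 ^ 2) / 3)) ^ (1 / 3 : ℝ))

/-- The pair `(aₙ, bₙ)` of the cubic arithmetic-geometric mean iteration started at
`(a₀, b₀) = (a, b)`. -/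
noncomputable def cubicAGSeq (a b : ℝ) : ℕ → ℝ × ℝ
  | 0 => (a, b)
  | n + 1 => cubicAGStep (cubicAGSeq a b n)

/-- The cubic arithmetic-geometric mean `ag₃(a, b)`: the limit of the sequence `aₙ` (that this
limit exists and is also the limit of `bₙ` is not built into the definition). -/
noncomputable def ag3 (a b : ℝ) : ℝ :=
  limUnder atTop (fun n => (cubicAGSeq a b n).1)

/-- The conjectural value `𝓛₊ = Γ(1/3) Γ(5/6) / Γ(1/6)` of Landau's constant. -/
noncomputable def landauPlus : ℝ :=
  Real.Gamma (1 / 3) * Real.Gamma (5 / 6) / Real.Gamma (1 / 6)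

section CubicPeriod

open MeasureTheory Set

/-! Write F for `cubicPeriod`, a multiple of ₂F₁(1/3, 2/3; 1; ·). The quantity F(1 - (b/a)³)/a does
not change under a cubic step: this is the transformation `cubicPeriod_transformation` at x = b/a.
Letting n → ∞ gives F(0)/L = F(1 - (b₀/a₀)³)/a₀ for the common limit L.

For a₀ = ∛2, b₀ = 1 the right-hand argument is 1/2. Both F(0) and F(1/2) are beta integrals; in the
quotient ∛2 and Γ(2/3) cancel, leaving 2𝓛₊.

The transformation holds because both sides solve (x(1 - x³)y')' = 2x²y, are regular at the singular
point x = 1, and agree there. -/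

/-! ### Differentiation under the integral sign -/

lemma rpow_le_add_of_mem_Icc {m M u : ℝ} (hm : 0 < m) (hu : u ∈ Icc m M) (s : ℝ) :
    u ^ s ≤ m ^ s + M ^ s := by
  have hu0 : 0 < u := hm.trans_le hu.1
  have hM : 0 < M := hu0.trans_le hu.2
  rcases le_total 0 s with hs | hs
  · have := Real.rpow_le_rpow hu0.le hu.2 hs
    have := Real.rpow_nonneg hm.le s
    linarith
  · have := Real.rpow_le_rpow_of_nonpos hm hu.1 hs
    have := Real.rpow_nonneg hM.le s
    linarith

/-- For z in this window around z₀, 1 - zt stays away from 0 and ∞ uniformly in t, so its powers are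
dominated by a constant. -/
lemma one_sub_mul_mem_Icc {z z₀ t : ℝ} (h1 : z₀ - 1 < z) (h2 : z < (1 + z₀) / 2)
    (ht : t ∈ Ioo (0 : ℝ) 1) (hz₀ : z₀ < 1) :
    1 - z * t ∈ Icc (min 1 ((1 - z₀) / 2)) (2 + |z₀|) := by
  obtain ⟨ht0, ht1⟩ := ht
  constructor
  · rcases le_total z 0 with hz | hz
    · exact (min_le_left _ _).trans (by nlinarith)
    · exact (min_le_right _ _).trans (by nlinarith)
  · have := neg_abs_le z₀
    have := abs_nonneg z₀
    rcases le_total z 0 with hz | hz <;> nlinarith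

lemma one_sub_mul_pos {z t : ℝ} (hz : z < 1) (ht : t ∈ Ioo (0 : ℝ) 1) : 0 < 1 - z * t := by
  obtain ⟨ht0, ht1⟩ := ht
  rcases le_total z 0 with h | h <;> nlinarith

lemma norm_one_sub_mul_rpow_le {z z₀ t : ℝ} (h1 : z₀ - 1 < z) (h2 : z < (1 + z₀) / 2)
    (ht : t ∈ Ioo (0 : ℝ) 1) (hz₀ : z₀ < 1) (s : ℝ) :
    ‖(1 - z * t) ^ s‖ ≤ (min 1 ((1 - z₀) / 2)) ^ s + (2 + |z₀|) ^ s := by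
  have hz : z < 1 := by linarith
  rw [Real.norm_of_nonneg (Real.rpow_nonneg (one_sub_mul_pos hz ht).le s)]
  exact rpow_le_add_of_mem_Icc (lt_min one_pos (by linarith))
    (one_sub_mul_mem_Icc h1 h2 ht hz₀) s

lemma integrableOn_mul_one_sub_mul_rpow {w : ℝ → ℝ} (hw : IntegrableOn w (Ioo 0 1)) {z : ℝ}
    (hz : z < 1) (s : ℝ) : IntegrableOn (fun t => w t * (1 - z * t) ^ s) (Ioo 0 1) := by
  refine Integrable.mul_bdd (c := (min 1 ((1 - z) / 2)) ^ s + (2 + |z|) ^ s) hw ?_ ?_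
  · exact Measurable.aestronglyMeasurable (by fun_prop)
  · exact ae_restrict_of_forall_mem measurableSet_Ioo fun t ht =>
      norm_one_sub_mul_rpow_le (by linarith) (by linarith) ht hz s

lemma hasDerivAt_integral_mul_one_sub_mul_rpow {w : ℝ → ℝ} (hw : IntegrableOn w (Ioo 0 1))
    {z₀ : ℝ} (hz₀ : z₀ < 1) (s : ℝ) :
    HasDerivAt (fun z => ∫ t in Ioo 0 1, w t * (1 - z * t) ^ s)
      (-s * ∫ t in Ioo 0 1, t * w t * (1 - z₀ * t) ^ (s - 1)) z₀ := by
  have hnhds : Ioo (z₀ - 1) ((1 + z₀) / 2) ∈ 𝓝 z₀ := Ioo_mem_nhds (by linarith) (by linarith)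
  have key := (hasDerivAt_integral_of_dominated_loc_of_deriv_le
    (μ := volume.restrict (Ioo (0 : ℝ) 1)) (F := fun z t => w t * (1 - z * t) ^ s)
    (F' := fun z t => -s * (t * w t * (1 - z * t) ^ (s - 1)))
    (bound := fun t => ‖w t‖ * (|s| * ((min 1 ((1 - z₀) / 2)) ^ (s - 1) + (2 + |z₀|) ^ (s - 1))))
    hnhds ?_ (integrableOn_mul_one_sub_mul_rpow hw hz₀ s) ?_ ?_ (hw.norm.mul_const _) ?_).2
  · rwa [integral_const_mul] at key
  · exact Eventually.of_forall fun z =>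
      hw.aestronglyMeasurable.mul (Measurable.aestronglyMeasurable (by fun_prop))
  · exact ((aestronglyMeasurable_id.mul hw.aestronglyMeasurable).mul
      (Measurable.aestronglyMeasurable (by fun_prop))).const_mul _
  · refine ae_restrict_of_forall_mem measurableSet_Ioo fun t ht z hz => ?_
    have hb := norm_one_sub_mul_rpow_le hz.1 hz.2 ht hz₀ (s - 1)
    have ht' : ‖t‖ ≤ 1 := by rw [Real.norm_of_nonneg ht.1.le]; exact ht.2.le
    calc ‖-s * (t * w t * (1 - z * t) ^ (s - 1))‖
        = ‖t‖ * (‖w t‖ * (|s| * ‖(1 - z * t) ^ (s - 1)‖)) := by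
          rw [norm_mul, norm_mul, norm_mul, norm_neg, Real.norm_eq_abs s]; ring
      _ ≤ 1 * (‖w t‖ * (|s| * ((min 1 ((1 - z₀) / 2)) ^ (s - 1) + (2 + |z₀|) ^ (s - 1)))) := by
          gcongr
      _ = _ := one_mul _
  · refine ae_restrict_of_forall_mem measurableSet_Ioo fun t ht z hz => ?_
    have hpos : 0 < 1 - z * t := one_sub_mul_pos (by linarith [hz.2]) ht
    have h1 : HasDerivAt (fun z => 1 - z * t) (-t) z := by
      simpa using ((hasDerivAt_id z).mul_const t).const_sub 1
    convert! (h1.rpow_const (p := s) (Or.inl hpos.ne')).const_mul (w t) using 1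
    ring

/-! ### Real beta integrals -/

lemma betaIntegrand_ofReal (u v : ℝ) {x : ℝ} (hx : x ∈ Ioc (0 : ℝ) 1) :
    (x : ℂ) ^ ((u : ℂ) - 1) * (1 - (x : ℂ)) ^ ((v : ℂ) - 1)
      = ((x ^ (u - 1) * (1 - x) ^ (v - 1) : ℝ) : ℂ) := by
  rw [Complex.ofReal_mul, Complex.ofReal_cpow hx.1.le, Complex.ofReal_cpow (by linarith [hx.2])]
  push_cast
  rfl

lemma integrableOn_rpow_mul_one_sub_rpow {u v : ℝ} (hu : 0 < u) (hv : 0 < v) :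
    IntegrableOn (fun t : ℝ => t ^ (u - 1) * (1 - t) ^ (v - 1)) (Ioo 0 1) := by
  have h := Complex.betaIntegral_convergent (u := u) (v := v) (by simpa) (by simpa)
  rw [intervalIntegrable_iff_integrableOn_Ioc_of_le zero_le_one] at h
  have h2 : IntegrableOn (fun t : ℝ => t ^ (u - 1) * (1 - t) ^ (v - 1)) (Ioc 0 1) :=
    IntegrableOn.congr_fun h.re (fun x hx => by
      rw [betaIntegrand_ofReal u v hx]; exact Complex.ofReal_re _) measurableSet_Ioc
  exact h2.mono_set Ioo_subset_Ioc_self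

lemma integral_rpow_mul_one_sub_rpow {u v : ℝ} (hu : 0 < u) (hv : 0 < v) :
    ∫ t in Ioo (0 : ℝ) 1, t ^ (u - 1) * (1 - t) ^ (v - 1)
      = Real.Gamma u * Real.Gamma v / Real.Gamma (u + v) := by
  have h := Complex.betaIntegral_eq_Gamma_mul_div u v (by simpa) (by simpa)
  rw [Complex.betaIntegral, intervalIntegral.integral_of_le zero_le_one,
    setIntegral_congr_fun measurableSet_Ioc (fun x hx => betaIntegrand_ofReal u v hx),
    integral_complex_ofReal, ← Complex.ofReal_add, Complex.Gamma_ofReal, Complex.Gamma_ofReal,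
    Complex.Gamma_ofReal] at h
  rw [← integral_Ioc_eq_integral_Ioo]
  exact_mod_cast h

/-! ### The Euler integral and its hypergeometric equation -/

/-- The Euler-type integral `∫₀¹ tᵏ t^(-1/3) (1 - t)^(-2/3) (1 - zt)ˢ dt`. -/
noncomputable def eulerIntegral (k : ℕ) (s z : ℝ) : ℝ :=
  ∫ t in Ioo (0 : ℝ) 1, t ^ k * (t ^ (2 / 3 - 1 : ℝ) * (1 - t) ^ (1 / 3 - 1 : ℝ)) * (1 - z * t) ^ s

lemma integrableOn_eulerWeight (k : ℕ) :
    IntegrableOn (fun t : ℝ => t ^ k * (t ^ (2 / 3 - 1 : ℝ) * (1 - t) ^ (1 / 3 - 1 : ℝ)))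
      (Ioo 0 1) := by
  refine Integrable.bdd_mul (c := 1)
    (integrableOn_rpow_mul_one_sub_rpow (u := 2 / 3) (v := 1 / 3) (by norm_num) (by norm_num))
    (Measurable.aestronglyMeasurable (by fun_prop)) ?_
  refine ae_restrict_of_forall_mem measurableSet_Ioo fun t ht => ?_
  rw [Real.norm_of_nonneg (pow_nonneg ht.1.le k)]
  exact pow_le_one₀ ht.1.le ht.2.le

lemma hasDerivAt_eulerIntegral (k : ℕ) (s : ℝ) {z : ℝ} (hz : z < 1) :
    HasDerivAt (eulerIntegral k s) (-s * eulerIntegral (k + 1) (s - 1) z) z := by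
  have h := hasDerivAt_integral_mul_one_sub_mul_rpow (integrableOn_eulerWeight k) hz s
  simp only [← mul_assoc, ← pow_succ'] at h
  have e : eulerIntegral k s = fun z => ∫ t in Ioo (0 : ℝ) 1,
      t ^ k * (t ^ (2 / 3 - 1 : ℝ) * (1 - t) ^ (1 / 3 - 1 : ℝ)) * (1 - z * t) ^ s := rfl
  simpa only [e, eulerIntegral, ← mul_assoc] using h

/-- The integral `∫₀¹ t^(-1/3) (1 - t)^(-2/3) (1 - zt)^(-1/3) dt`, which is a constant multiple of
the hypergeometric function `₂F₁(1/3, 2/3; 1; z)`. -/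
noncomputable def cubicPeriod (z : ℝ) : ℝ := eulerIntegral 0 (-1 / 3) z

/-- The derivative of `cubicPeriod`. -/
noncomputable def cubicPeriodDeriv (z : ℝ) : ℝ := 1 / 3 * eulerIntegral 1 (-4 / 3) z

/-- The second derivative of `cubicPeriod`. -/
noncomputable def cubicPeriodDeriv₂ (z : ℝ) : ℝ := 4 / 9 * eulerIntegral 2 (-7 / 3) z

lemma hasDerivAt_cubicPeriod {z : ℝ} (hz : z < 1) :
    HasDerivAt cubicPeriod (cubicPeriodDeriv z) z := by
  convert! hasDerivAt_eulerIntegral 0 (-1 / 3) hz using 1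
  rw [cubicPeriodDeriv]
  norm_num

lemma hasDerivAt_cubicPeriodDeriv {z : ℝ} (hz : z < 1) :
    HasDerivAt cubicPeriodDeriv (cubicPeriodDeriv₂ z) z := by
  convert! (hasDerivAt_eulerIntegral 1 (-4 / 3) hz).const_mul (1 / 3) using 1
  rw [cubicPeriodDeriv₂]
  norm_num
  ring

lemma cubicPeriod_pos {z : ℝ} (hz : z < 1) : 0 < cubicPeriod z := by
  have hpos : ∀ t ∈ Ioo (0 : ℝ) 1, 0 < t ^ 0 * (t ^ (2 / 3 - 1 : ℝ) * (1 - t) ^ (1 / 3 - 1 : ℝ)) *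
      (1 - z * t) ^ (-1 / 3 : ℝ) := fun t ht => by
    have := one_sub_mul_pos hz ht
    have := ht.1
    have : 0 < 1 - t := sub_pos.2 ht.2
    positivity
  rw [cubicPeriod, eulerIntegral, setIntegral_pos_iff_support_of_nonneg_ae
    (ae_restrict_of_forall_mem measurableSet_Ioo fun t ht => (hpos t ht).le)
    (integrableOn_mul_one_sub_mul_rpow (integrableOn_eulerWeight 0) hz _)]
  rw [inter_eq_right.2 fun t ht => Function.mem_support.2 (hpos t ht).ne']
  simp

lemma hasDerivAt_boundaryTerm {z t : ℝ} (hz : z < 1) (ht : t ∈ Ioo (0 : ℝ) 1) :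
    HasDerivAt (fun t : ℝ => t ^ (2 / 3 : ℝ) * (1 - t) ^ (1 / 3 : ℝ) * (1 - z * t) ^ (-4 / 3 : ℝ))
      ((2 / 3 * (1 - t) * (1 - z * t) - 1 / 3 * t * (1 - z * t) + 4 / 3 * z * t * (1 - t)) *
        (t ^ (2 / 3 - 1 : ℝ) * (1 - t) ^ (1 / 3 - 1 : ℝ) * (1 - z * t) ^ (-4 / 3 - 1 : ℝ))) t := by
  have hz' := one_sub_mul_pos hz ht
  have ht' : 0 < 1 - t := sub_pos.2 ht.2
  have h1 : HasDerivAt (fun t : ℝ => 1 - z * t) (-z) t := by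
    simpa using ((hasDerivAt_id t).const_mul z).const_sub 1
  have h2 : HasDerivAt (fun t : ℝ => 1 - t) (-1) t := (hasDerivAt_id t).const_sub 1
  have h3 := Real.hasDerivAt_rpow_const (x := t) (p := 2 / 3) (Or.inl ht.1.ne')
  have e1 : t ^ (2 / 3 : ℝ) = t ^ (2 / 3 - 1 : ℝ) * t := by
    rw [Real.rpow_sub_one ht.1.ne', div_mul_cancel₀ _ ht.1.ne']
  have e2 : (1 - t) ^ (1 / 3 : ℝ) = (1 - t) ^ (1 / 3 - 1 : ℝ) * (1 - t) := by
    rw [Real.rpow_sub_one ht'.ne', div_mul_cancel₀ _ ht'.ne']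
  have e3 : (1 - z * t) ^ (-4 / 3 : ℝ) = (1 - z * t) ^ (-4 / 3 - 1 : ℝ) * (1 - z * t) := by
    rw [Real.rpow_sub_one hz'.ne', div_mul_cancel₀ _ hz'.ne']
  convert! (h3.mul (h2.rpow_const (p := 1 / 3) (Or.inl ht'.ne'))).mul
    (h1.rpow_const (p := -4 / 3) (Or.inl hz'.ne')) using 1
  simp only [Pi.mul_apply, e1, e2, e3]
  ring

/-- Under the integral sign, left minus right side is -1/3 times the t-derivative in
`hasDerivAt_boundaryTerm`, whose primitive vanishes at t = 0 and t = 1. -/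
lemma cubicPeriod_ode {z : ℝ} (hz : z < 1) :
    z * (1 - z) * cubicPeriodDeriv₂ z + (1 - 2 * z) * cubicPeriodDeriv z
      = 2 / 9 * cubicPeriod z := by
  have i0 := integrableOn_mul_one_sub_mul_rpow (integrableOn_eulerWeight 0) hz (-1 / 3)
  have i1 := integrableOn_mul_one_sub_mul_rpow (integrableOn_eulerWeight 1) hz (-4 / 3)
  have i2 := integrableOn_mul_one_sub_mul_rpow (integrableOn_eulerWeight 2) hz (-7 / 3)
  have hsum := ((i2.const_mul (z * (1 - z) * (4 / 9))).add
    (i1.const_mul ((1 - 2 * z) * (1 / 3)))).sub (i0.const_mul (2 / 9))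
  have hcong : ∀ t ∈ Ioo (0 : ℝ) 1,
      -3 * (z * (1 - z) * (4 / 9) * (t ^ 2 * (t ^ (2 / 3 - 1 : ℝ) * (1 - t) ^ (1 / 3 - 1 : ℝ)) *
          (1 - z * t) ^ (-7 / 3 : ℝ))
        + (1 - 2 * z) * (1 / 3) * (t ^ 1 * (t ^ (2 / 3 - 1 : ℝ) * (1 - t) ^ (1 / 3 - 1 : ℝ)) *
          (1 - z * t) ^ (-4 / 3 : ℝ))
        - 2 / 9 * (t ^ 0 * (t ^ (2 / 3 - 1 : ℝ) * (1 - t) ^ (1 / 3 - 1 : ℝ)) *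
          (1 - z * t) ^ (-1 / 3 : ℝ)))
      = (2 / 3 * (1 - t) * (1 - z * t) - 1 / 3 * t * (1 - z * t) + 4 / 3 * z * t * (1 - t)) *
        (t ^ (2 / 3 - 1 : ℝ) * (1 - t) ^ (1 / 3 - 1 : ℝ) * (1 - z * t) ^ (-4 / 3 - 1 : ℝ)) := by
    intro t ht
    have hz' := one_sub_mul_pos hz ht
    have e1 : (1 - z * t) ^ (-4 / 3 : ℝ) = (1 - z * t) ^ (-7 / 3 : ℝ) * (1 - z * t) := by
      rw [← Real.rpow_add_one hz'.ne']; norm_num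
    have e2 : (1 - z * t) ^ (-1 / 3 : ℝ) = (1 - z * t) ^ (-7 / 3 : ℝ) * (1 - z * t) ^ 2 := by
      rw [← Real.rpow_add_natCast hz'.ne']; norm_num
    have e3 : (-4 / 3 - 1 : ℝ) = -7 / 3 := by norm_num
    rw [e1, e2, e3]
    ring
  have hint := IntegrableOn.congr_fun (hsum.const_mul (-3)) hcong measurableSet_Ioo
  have i21 := (i2.const_mul (z * (1 - z) * (4 / 9))).add (i1.const_mul ((1 - 2 * z) * (1 / 3)))
  simp only [Pi.add_def] at i21
  have hFTC := intervalIntegral.integral_eq_sub_of_hasDerivAt_of_le zero_le_one (f := fun t : ℝ =>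
      t ^ (2 / 3 : ℝ) * (1 - t) ^ (1 / 3 : ℝ) * (1 - z * t) ^ (-4 / 3 : ℝ)) ?_
    (fun t ht => hasDerivAt_boundaryTerm hz ht)
    ((intervalIntegrable_iff_integrableOn_Ioo_of_le zero_le_one).2 hint)
  · rw [intervalIntegral.integral_of_le zero_le_one, integral_Ioc_eq_integral_Ioo,
      ← setIntegral_congr_fun measurableSet_Ioo hcong, integral_const_mul,
      integral_sub i21 (i0.const_mul _),
      integral_add (i2.const_mul _) (i1.const_mul _),
      integral_const_mul, integral_const_mul, integral_const_mul] at hFTC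
    norm_num at hFTC
    simp only [cubicPeriod, cubicPeriodDeriv, cubicPeriodDeriv₂, eulerIntegral]
    norm_num
    linarith
  · refine ContinuousOn.mul (ContinuousOn.mul ?_ ?_) ?_
    · exact continuousOn_id.rpow_const fun _ _ => Or.inr (by norm_num)
    · exact ContinuousOn.rpow_const (by fun_prop) fun _ _ => Or.inr (by norm_num)
    · refine ContinuousOn.rpow_const (by fun_prop) fun t ht => Or.inl ?_
      obtain ⟨h0, h1⟩ := ht
      rcases le_total z 0 with h | h <;> nlinarith

/-! ### The cubic transformation -/

lemma hasDerivAt_cubicPeriod_comp {u : ℝ → ℝ} {u' x : ℝ} (hu : HasDerivAt u u' x) (hx : u x < 1) :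
    HasDerivAt (fun x => cubicPeriod (u x)) (cubicPeriodDeriv (u x) * u') x :=
  (hasDerivAt_cubicPeriod hx).comp x hu

lemma hasDerivAt_cubicPeriodDeriv_comp {u : ℝ → ℝ} {u' x : ℝ} (hu : HasDerivAt u u' x)
    (hx : u x < 1) :
    HasDerivAt (fun x => cubicPeriodDeriv (u x)) (cubicPeriodDeriv₂ (u x) * u') x :=
  (hasDerivAt_cubicPeriodDeriv hx).comp x hu

lemma one_sub_pow_three_lt_one {x : ℝ} (hx : 0 < x) : 1 - x ^ 3 < 1 := by
  have := pow_pos hx 3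
  linarith

lemma cubicModulus_lt_one {x : ℝ} (hx : 0 < x) : ((1 - x) / (1 + 2 * x)) ^ 3 < 1 := by
  have h : (1 - x) / (1 + 2 * x) < 1 := by
    rw [div_lt_one (by linarith)]
    linarith
  by_contra! hc
  have h3 : (0 : ℝ) ≤ (1 - x) / (1 + 2 * x) := by
    by_contra! hn
    have : ((1 - x) / (1 + 2 * x)) ^ 3 < 0 := Odd.pow_neg (by decide) hn
    linarith
  exact absurd (pow_lt_one₀ h3 h (n := 3) (by norm_num)) (not_lt.2 hc)

lemma hasDerivAt_cubicModulus {x : ℝ} (hx : 0 < x) :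
    HasDerivAt (fun x : ℝ => ((1 - x) / (1 + 2 * x)) ^ 3)
      (-9 * (1 - x) ^ 2 / (1 + 2 * x) ^ 4) x := by
  have hne : 1 + 2 * x ≠ 0 := by positivity
  have h2 : HasDerivAt (fun x : ℝ => 1 + 2 * x) 2 x := by
    simpa using ((hasDerivAt_id x).const_mul 2).const_add 1
  convert! (((hasDerivAt_id x).const_sub 1).div h2 hne).pow 3 using 1
  simp
  field_simp
  ring

/-- The derivative of `x ↦ F(1 - x³)`, where `F` is `cubicPeriod`. -/
lemma hasDerivAt_cubicPeriod_left {x : ℝ} (hx : 0 < x) :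
    HasDerivAt (fun x => cubicPeriod (1 - x ^ 3))
      (-3 * x ^ 2 * cubicPeriodDeriv (1 - x ^ 3)) x := by
  convert! hasDerivAt_cubicPeriod_comp ((hasDerivAt_pow 3 x).const_sub 1)
    (one_sub_pow_three_lt_one hx) using 1
  norm_num
  ring

lemma cubicPeriod_left_ode {x : ℝ} (hx : 0 < x) :
    HasDerivAt (fun x => x * (1 - x ^ 3) * (-3 * x ^ 2 * cubicPeriodDeriv (1 - x ^ 3)))
      (2 * x ^ 2 * cubicPeriod (1 - x ^ 3)) x := by
  have h1 := hasDerivAt_cubicPeriodDeriv_comp ((hasDerivAt_pow 3 x).const_sub 1)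
    (one_sub_pow_three_lt_one hx)
  have hp := (hasDerivAt_id x).mul ((hasDerivAt_pow 3 x).const_sub 1)
  have ode := cubicPeriod_ode (one_sub_pow_three_lt_one hx)
  convert! hp.mul (((hasDerivAt_pow 2 x).const_mul (-3)).mul h1) using 1
  simp
  -- With z = 1 - x³ the differentiated function is -3z(1 - z)F'(z), and dz/dx = -3x².
  linear_combination (-9 * x ^ 2) * ode

lemma hasDerivAt_three_div {x : ℝ} (hx : 0 < x) :
    HasDerivAt (fun x : ℝ => 3 / (1 + 2 * x)) (-6 / (1 + 2 * x) ^ 2) x := by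
  have hne : 1 + 2 * x ≠ 0 := by positivity
  have h2 : HasDerivAt (fun x : ℝ => 1 + 2 * x) 2 x := by
    simpa using ((hasDerivAt_id x).const_mul 2).const_add 1
  convert! (hasDerivAt_const x 3).div h2 hne using 1
  norm_num

lemma hasDerivAt_cubicPeriod_right {x : ℝ} (hx : 0 < x) :
    HasDerivAt (fun x => 3 / (1 + 2 * x) * cubicPeriod (((1 - x) / (1 + 2 * x)) ^ 3))
      (-6 / (1 + 2 * x) ^ 2 * cubicPeriod (((1 - x) / (1 + 2 * x)) ^ 3) -
        27 * (1 - x) ^ 2 / (1 + 2 * x) ^ 5 * cubicPeriodDeriv (((1 - x) / (1 + 2 * x)) ^ 3)) x := by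
  have hne : 1 + 2 * x ≠ 0 := by positivity
  convert! (hasDerivAt_three_div hx).mul (hasDerivAt_cubicPeriod_comp (hasDerivAt_cubicModulus hx)
    (cubicModulus_lt_one hx)) using 1
  field_simp
  ring

lemma cubicPeriod_right_ode {x : ℝ} (hx : 0 < x) :
    HasDerivAt (fun x => x * (1 - x ^ 3) *
      (-6 / (1 + 2 * x) ^ 2 * cubicPeriod (((1 - x) / (1 + 2 * x)) ^ 3) -
        27 * (1 - x) ^ 2 / (1 + 2 * x) ^ 5 * cubicPeriodDeriv (((1 - x) / (1 + 2 * x)) ^ 3)))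
      (2 * x ^ 2 * (3 / (1 + 2 * x) * cubicPeriod (((1 - x) / (1 + 2 * x)) ^ 3))) x := by
  have hne : 1 + 2 * x ≠ 0 := by positivity
  have hu := cubicModulus_lt_one hx
  have h0 := hasDerivAt_cubicPeriod_comp (hasDerivAt_cubicModulus hx) hu
  have h1 := hasDerivAt_cubicPeriodDeriv_comp (hasDerivAt_cubicModulus hx) hu
  have hp := (hasDerivAt_id x).mul ((hasDerivAt_pow 3 x).const_sub 1)
  have hl : HasDerivAt (fun x : ℝ => 1 + 2 * x) 2 x := by
    simpa using ((hasDerivAt_id x).const_mul 2).const_add 1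
  have hc := (hasDerivAt_const x (-6 : ℝ)).div (hl.pow 2) (pow_ne_zero 2 hne)
  have hd := ((((hasDerivAt_id x).const_sub 1).pow 2).const_mul 27).div (hl.pow 5)
    (pow_ne_zero 5 hne)
  have ode := cubicPeriod_ode hu
  convert! hp.mul ((hc.mul h0).sub (hd.mul h1)) using 1
  simp only [Pi.mul_apply, Pi.sub_apply, Pi.div_apply, Pi.pow_apply, id]
  generalize cubicPeriod (((1 - x) / (1 + 2 * x)) ^ 3) = f₀ at *
  generalize cubicPeriodDeriv (((1 - x) / (1 + 2 * x)) ^ 3) = f₁ at *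
  generalize cubicPeriodDeriv₂ (((1 - x) / (1 + 2 * x)) ^ 3) = f₂ at *
  rw [← sub_eq_zero] at ode ⊢
  -- The factor matches the F'' terms: with u = ((1 - x)/(1 + 2x))³, 1 - u = 9x(1 + x + x²)/(1 +
  -- 2x)³.
  refine Eq.trans ?_ ((congrArg (-(27 * (1 - x) ^ 2 / (1 + 2 * x) ^ 3) * ·) ode).trans (mul_zero _))
  simp only [Nat.cast_ofNat]
  field_simp
  ring

/-- The cubic transformation `F(1 - x³) = 3/(1 + 2x) F(((1 - x)/(1 + 2x))³)`. -/
theorem cubicPeriod_transformation {x : ℝ} (hx : 0 < x) (hx1 : x ≤ 1) :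
    cubicPeriod (1 - x ^ 3) = 3 / (1 + 2 * x) * cubicPeriod (((1 - x) / (1 + 2 * x)) ^ 3) := by
  set f : ℝ → ℝ := fun x => cubicPeriod (1 - x ^ 3) with hf
  set g : ℝ → ℝ := fun x => 3 / (1 + 2 * x) * cubicPeriod (((1 - x) / (1 + 2 * x)) ^ 3) with hg
  obtain ⟨f', hf', hfp⟩ : ∃ f' : ℝ → ℝ, (∀ y, 0 < y → HasDerivAt f (f' y) y) ∧
      ∀ y, 0 < y → HasDerivAt (fun y => y * (1 - y ^ 3) * f' y) (2 * y ^ 2 * f y) y :=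
    ⟨_, fun _ => hasDerivAt_cubicPeriod_left, fun _ => cubicPeriod_left_ode⟩
  obtain ⟨g', hg', hgp⟩ : ∃ g' : ℝ → ℝ, (∀ y, 0 < y → HasDerivAt g (g' y) y) ∧
      ∀ y, 0 < y → HasDerivAt (fun y => y * (1 - y ^ 3) * g' y) (2 * y ^ 2 * g y) y :=
    ⟨_, fun _ => hasDerivAt_cubicPeriod_right, fun _ => cubicPeriod_right_ode⟩
  have hfpos : ∀ y, 0 < y → 0 < f y := fun y hy => cubicPeriod_pos (one_sub_pow_three_lt_one hy)
  -- The Wronskian times y(1 - y³) is constant, and it vanishes at the singular point y = 1.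
  have hW : ∀ y, 0 < y → HasDerivAt (fun y => f y * (y * (1 - y ^ 3) * g' y) -
      g y * (y * (1 - y ^ 3) * f' y)) 0 y := fun y hy => by
    convert! ((hf' y hy).mul (hgp y hy)).sub ((hg' y hy).mul (hfp y hy)) using 1
    ring
  have hW0 : ∀ y ∈ Icc x 1, f y * (y * (1 - y ^ 3) * g' y) - g y * (y * (1 - y ^ 3) * f' y) = 0 := by
    intro y hy
    have hc := constant_of_has_deriv_right_zero (a := x) (b := 1)
      (fun y hy => (hW y (hx.trans_le hy.1)).continuousAt.continuousWithinAt)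
      (fun y hy => (hW y (hx.trans_le hy.1)).hasDerivWithinAt)
    rw [hc y hy, ← hc 1 ⟨hx1, le_rfl⟩]
    ring
  have hR : ∀ y, 0 < y → HasDerivAt (fun y => g y / f y)
      ((g' y * f y - g y * f' y) / f y ^ 2) y :=
    fun y hy => (hg' y hy).div (hf' y hy) (hfpos y hy).ne'
  -- The derivative is needed only on [x, 1), where y(1 - y³) ≠ 0 can be cancelled.
  have hc := constant_of_has_deriv_right_zero (f := fun y => g y / f y) (a := x) (b := 1)
    (fun y hy => (hR y (hx.trans_le hy.1)).continuousAt.continuousWithinAt)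
    (fun y hy => by
      have hy0 := hx.trans_le hy.1
      have hne : y * (1 - y ^ 3) ≠ 0 :=
        mul_ne_zero hy0.ne' (sub_pos.2 (pow_lt_one₀ hy0.le hy.2 (by norm_num))).ne'
      have h0 : g' y * f y - g y * f' y = 0 := by
        refine (mul_eq_zero.1 ?_).resolve_left hne
        linear_combination hW0 y ⟨hy.1, hy.2.le⟩
      have := (hR y hy0).hasDerivWithinAt (s := Ici y)
      rwa [h0, zero_div] at this) 1 ⟨hx1, le_rfl⟩
  have h1 : g 1 / f 1 = 1 := by
    have h := (hfpos 1 one_pos).ne'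
    have e : g 1 = f 1 := by simp only [hf, hg]; norm_num
    rw [e, div_self h]
  have h2 : g x / f x = 1 := hc.symm.trans h1
  exact ((div_eq_one_iff_eq (hfpos x hx).ne').1 h2).symm

/-! ### Special values at 0 and 1/2 -/

lemma cubicPeriod_zero : cubicPeriod 0 = Real.Gamma (2 / 3) * Real.Gamma (1 / 3) := by
  have h := integral_rpow_mul_one_sub_rpow (u := 2 / 3) (v := 1 / 3) (by norm_num) (by norm_num)
  rw [show (2 / 3 + 1 / 3 : ℝ) = 1 by norm_num, Real.Gamma_one, div_one] at h
  rw [← h, cubicPeriod, eulerIntegral]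
  simp

lemma image_one_sub_sq_Ioo : (fun t : ℝ => (1 - t) ^ 2) '' Ioo 0 1 = Ioo 0 1 := by
  ext u
  constructor
  · rintro ⟨t, ⟨h0, h1⟩, rfl⟩
    constructor <;> nlinarith
  · rintro ⟨h0, h1⟩
    have hs : 0 < √u := Real.sqrt_pos.2 h0
    have hs1 : √u < 1 := by rwa [Real.sqrt_lt' one_pos, one_pow]
    refine ⟨1 - √u, ⟨by linarith, by linarith⟩, ?_⟩
    simp only [sub_sub_cancel]
    exact Real.sq_sqrt h0.le

/-- Substituting u = (1 - t)² gives 1 - u = 2t(1 - t/2), which absorbs the third factor and leaves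
B(1/6, 2/3). -/
lemma cubicPeriod_one_half :
    cubicPeriod (1 / 2) = 2 ^ (1 / 3 : ℝ) / 2 *
      (Real.Gamma (1 / 6) * Real.Gamma (2 / 3) / Real.Gamma (5 / 6)) := by
  have h := integral_rpow_mul_one_sub_rpow (u := 1 / 6) (v := 2 / 3) (by norm_num) (by norm_num)
  rw [show (1 / 6 + 2 / 3 : ℝ) = 5 / 6 by norm_num, ← image_one_sub_sq_Ioo,
    integral_image_eq_integral_abs_deriv_smul (f' := fun t => -2 * (1 - t)) measurableSet_Ioo] at h
  · rw [← h, cubicPeriod, eulerIntegral, ← integral_const_mul]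
    refine setIntegral_congr_fun measurableSet_Ioo fun t ht => ?_
    obtain ⟨h0, h1⟩ := ht
    have hp : 0 < 1 - t := sub_pos.2 h1
    have hq : 0 < 2 - t := by linarith
    have e1 : |(-2 * (1 - t))| = 2 * (1 - t) := by
      rw [abs_of_nonpos (by linarith)]; ring
    have e2 : ((1 - t) ^ 2) ^ (1 / 6 - 1 : ℝ) = (1 - t) ^ (1 / 3 - 1 : ℝ) * (1 - t)⁻¹ := by
      rw [← Real.rpow_natCast, ← Real.rpow_mul hp.le, ← Real.rpow_neg_one, ← Real.rpow_add hp]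
      norm_num
    have e3 : (1 - (1 - t) ^ 2) ^ (2 / 3 - 1 : ℝ) =
        t ^ (2 / 3 - 1 : ℝ) * (2 - t) ^ (-1 / 3 : ℝ) := by
      rw [show 1 - (1 - t) ^ 2 = t * (2 - t) by ring, Real.mul_rpow h0.le hq.le]
      norm_num
    have e4 : (1 - 1 / 2 * t) ^ (-1 / 3 : ℝ) = 2 ^ (1 / 3 : ℝ) * (2 - t) ^ (-1 / 3 : ℝ) := by
      rw [show 1 - 1 / 2 * t = 2⁻¹ * (2 - t) by ring, Real.mul_rpow (by norm_num) hq.le,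
        Real.inv_rpow zero_le_two, ← Real.rpow_neg zero_le_two]
      norm_num
    simp only [smul_eq_mul, e1, e2, e3, e4]
    field_simp
  · intro t _
    convert! (((hasDerivAt_id t).const_sub 1).pow 2).hasDerivWithinAt using 1
    norm_num
  · intro s hs t ht hst
    have := (sq_eq_sq₀ (sub_pos.2 hs.2).le (sub_pos.2 ht.2).le).1 hst
    linarith

/-! ### The iteration and its limit -/

lemma cubicAGStep_snd_pow_three {a b : ℝ} (ha : 0 < a) (hb : 0 < b) :
    (cubicAGStep (a, b)).2 ^ 3 = b * ((a ^ 2 + a * b + b ^ 2) / 3) := by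
  have h : 0 ≤ b * ((a ^ 2 + a * b + b ^ 2) / 3) := by positivity
  rw [cubicAGStep, ← Real.rpow_natCast, ← Real.rpow_mul h]
  norm_num

/-- With (a', b') the next pair, b'³ - b³ = b(a - b)(a + 2b)/3 and a'³ - b'³ = ((a - b)/3)³. -/
lemma cubicAGStep_bounds {a b : ℝ} (hb : 0 < b) (hab : b ≤ a) :
    b ≤ (cubicAGStep (a, b)).2 ∧ (cubicAGStep (a, b)).2 ≤ (cubicAGStep (a, b)).1 ∧
      (cubicAGStep (a, b)).1 ≤ a := by
  have ha : 0 < a := hb.trans_le hab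
  have h3 := cubicAGStep_snd_pow_three ha hb
  have h0 : 0 ≤ (cubicAGStep (a, b)).2 := Real.rpow_nonneg (by positivity) _
  have h1 : (cubicAGStep (a, b)).1 = (a + 2 * b) / 3 := rfl
  refine ⟨?_, ?_, by rw [h1]; linarith⟩
  · refine le_of_pow_le_pow_left₀ three_ne_zero h0 ?_
    rw [h3]
    have : 0 ≤ b * ((a - b) * (a + 2 * b)) :=
      mul_nonneg hb.le (mul_nonneg (sub_nonneg.2 hab) (by linarith))
    linarith
  · refine le_of_pow_le_pow_left₀ three_ne_zero (by rw [h1]; linarith) ?_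
    rw [h3, h1]
    have := pow_nonneg (sub_nonneg.2 hab) 3
    linarith

/-- The invariance of `F(1 - (b/a)³)/a` under the cubic arithmetic-geometric mean step. -/
lemma cubicPeriod_cubicAGStep {a b : ℝ} (hb : 0 < b) (hab : b ≤ a) :
    cubicPeriod (1 - ((cubicAGStep (a, b)).2 / (cubicAGStep (a, b)).1) ^ 3) /
      (cubicAGStep (a, b)).1 = cubicPeriod (1 - (b / a) ^ 3) / a := by
  have ha : 0 < a := hb.trans_le hab
  have h1 : (cubicAGStep (a, b)).1 = (a + 2 * b) / 3 := rfl
  have hne : a + 2 * b ≠ 0 := by positivity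
  have hx : (1 - b / a) / (1 + 2 * (b / a)) = (a - b) / (a + 2 * b) := by field_simp
  rw [div_pow, cubicAGStep_snd_pow_three ha hb, h1,
    cubicPeriod_transformation (div_pos hb ha) ((div_le_one ha).2 hab), hx,
    show 1 - b * ((a ^ 2 + a * b + b ^ 2) / 3) / ((a + 2 * b) / 3) ^ 3
      = ((a - b) / (a + 2 * b)) ^ 3 by field_simp; ring]
  field_simp

lemma cubicAGSeq_invariants {a b : ℝ} (hb : 0 < b) (hab : b ≤ a) (n : ℕ) :
    b ≤ (cubicAGSeq a b n).2 ∧ (cubicAGSeq a b n).2 ≤ (cubicAGSeq a b n).1 ∧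
      cubicPeriod (1 - ((cubicAGSeq a b n).2 / (cubicAGSeq a b n).1) ^ 3) / (cubicAGSeq a b n).1
        = cubicPeriod (1 - (b / a) ^ 3) / a := by
  induction n with
  | zero => exact ⟨le_rfl, hab, rfl⟩
  | succ n ih =>
    obtain ⟨h1, h2, h3⟩ := ih
    have hb' := hb.trans_le h1
    obtain ⟨h4, h5, -⟩ := cubicAGStep_bounds hb' h2
    exact ⟨h1.trans h4, h5, (cubicPeriod_cubicAGStep hb' h2).trans h3⟩

lemma exists_tendsto_cubicAGSeq {a b : ℝ} (hb : 0 < b) (hab : b ≤ a) :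
    ∃ L, b ≤ L ∧ Tendsto (fun n => (cubicAGSeq a b n).1) atTop (𝓝 L) ∧
      Tendsto (fun n => (cubicAGSeq a b n).2) atTop (𝓝 L) := by
  have hinv := cubicAGSeq_invariants hb hab
  have hlow : ∀ n, b ≤ (cubicAGSeq a b n).1 := fun n => (hinv n).1.trans (hinv n).2.1
  have hanti : Antitone fun n => (cubicAGSeq a b n).1 := antitone_nat_of_succ_le fun n =>
    (cubicAGStep_bounds (hb.trans_le (hinv n).1) (hinv n).2.1).2.2
  have ht := tendsto_atTop_ciInf hanti ⟨b, by rintro _ ⟨n, rfl⟩; exact hlow n⟩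
  refine ⟨_, ge_of_tendsto' ht hlow, ht, ?_⟩
  -- Since bₙ = (3aₙ₊₁ - aₙ)/2, convergence of aₙ alone suffices.
  have h2 := (((tendsto_add_atTop_iff_nat 1).2 ht).const_mul 3).sub ht |>.div_const 2
  convert! h2 using 1
  · funext n
    have : (cubicAGSeq a b (n + 1)).1 = ((cubicAGSeq a b n).1 + 2 * (cubicAGSeq a b n).2) / 3 := rfl
    rw [this]
    ring
  · congr 1
    ring

/-- The cubic arithmetic-geometric mean in terms of the hypergeometric integral. -/
theorem cubicPeriod_div_of_tendsto {a b L : ℝ} (hb : 0 < b) (hab : b ≤ a) (hL : 0 < L)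
    (h1 : Tendsto (fun n => (cubicAGSeq a b n).1) atTop (𝓝 L))
    (h2 : Tendsto (fun n => (cubicAGSeq a b n).2) atTop (𝓝 L)) :
    cubicPeriod 0 / L = cubicPeriod (1 - (b / a) ^ 3) / a := by
  have hz : Tendsto (fun n => 1 - ((cubicAGSeq a b n).2 / (cubicAGSeq a b n).1) ^ 3) atTop
      (𝓝 0) := by
    simpa [div_self hL.ne'] using ((h2.div h1 hL.ne').pow 3).const_sub 1
  have hF := (hasDerivAt_cubicPeriod zero_lt_one).continuousAt.tendsto.comp hz
  refine tendsto_nhds_unique (hF.div h1 hL.ne') ?_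
  exact tendsto_const_nhds.congr fun n => ((cubicAGSeq_invariants hb hab n).2.2).symm

end CubicPeriod

theorem mainTheorem3 :
    Tendsto (fun n => (cubicAGSeq ((2 : ℝ) ^ (1 / 3 : ℝ)) 1 n).1) atTop
        (𝓝 (ag3 ((2 : ℝ) ^ (1 / 3 : ℝ)) 1)) ∧
      Tendsto (fun n => (cubicAGSeq ((2 : ℝ) ^ (1 / 3 : ℝ)) 1 n).2) atTop
        (𝓝 (ag3 ((2 : ℝ) ^ (1 / 3 : ℝ)) 1)) ∧
      ag3 ((2 : ℝ) ^ (1 / 3 : ℝ)) 1 = 2 * landauPlus := by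
  have hab : (1 : ℝ) ≤ 2 ^ (1 / 3 : ℝ) := Real.one_le_rpow one_le_two (by norm_num)
  obtain ⟨L, hL, h1, h2⟩ := exists_tendsto_cubicAGSeq one_pos hab
  have hL0 : 0 < L := one_pos.trans_le hL
  have hag : ag3 ((2 : ℝ) ^ (1 / 3 : ℝ)) 1 = L := h1.limUnder_eq
  rw [hag]
  refine ⟨h1, h2, ?_⟩
  have key := cubicPeriod_div_of_tendsto one_pos hab hL0 h1 h2
  have hcube : ((2 : ℝ) ^ (1 / 3 : ℝ)) ^ 3 = 2 := by
    rw [← Real.rpow_natCast, ← Real.rpow_mul zero_le_two]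
    norm_num
  rw [div_pow, hcube, show (1 - 1 ^ 3 / 2 : ℝ) = 1 / 2 by norm_num, cubicPeriod_zero,
    cubicPeriod_one_half] at key
  have g1 := Real.Gamma_pos_of_pos (show (0 : ℝ) < 1 / 6 by norm_num)
  have g2 := Real.Gamma_pos_of_pos (show (0 : ℝ) < 2 / 3 by norm_num)
  have g3 := Real.Gamma_pos_of_pos (show (0 : ℝ) < 5 / 6 by norm_num)
  have hr : (0 : ℝ) < 2 ^ (1 / 3 : ℝ) := one_pos.trans_le hab
  rw [landauPlus]
  generalize (2 : ℝ) ^ (1 / 3 : ℝ) = r at *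
  generalize Real.Gamma (1 / 6) = x at *
  generalize Real.Gamma (2 / 3) = y at *
  generalize Real.Gamma (5 / 6) = z at *
  generalize Real.Gamma (1 / 3) = v at *
  field_simp at key ⊢
  linarith
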